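/- **Setting.** Consider the switched stochastic system $x_{k+1}=f_{u_k}(x_k)+v_k$ on $\mathbb R^n$, where $u_k\in U=\{1,\dots,m\}$, every $f_u:\mathbb R^n\to\mathbb R^n$ is continuous, and the noise $v_k$ is i.i.d. with law $p_v$. Let $s\ge 1$, $\varepsilon\ge 0$, let $\widehat p_v$ be a probability distribution on $\mathbb R^n$ with finite $s$-th moment, and let $\mathcal P_v$ be the set of all distributions $p$ on $\mathbb R^n$ with finite $s$-th moment and $\mathcal W_s(p,\widehat p_v)\le\varepsilon$, where $\mathcal W_s$ is the $s$-Wasserstein distance for the Euclidean norm. Put $T^u_p(B\mid x)=p(\{v: f_u(x)+v\in B\})$. A switching strategy $\sigma_x$ maps finite paths $x_0\xrightarrow{u_0}\cdots\xrightarrow{u_{k-1}}x_k$ to modes; together with $x_0$ and $p_v$ it determines, by the Ionescu-Tulcea theorem, the law $P^{x_0,\sigma_x}_{p_v}$ of the state sequence $\omega$. Let $X\subset\mathbb R^n$ be bounded, $X_{\rm tgt}\subset X$, and $K\in\mathbb N_0\cup\{\infty\}$. For $x_0\in\mathbb R^n$ put $$P_{\rm reach}(X,X_{\rm tgt},K\mid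 x_0,\sigma_x,p_v)=P^{x_0,\sigma_x}_{p_v}\big[\exists k\in\mathbb N_0,\ k\le K:\ \omega(k)\in X_{\rm tgt}\ \wedge\ \forall k'<k,\ \omega(k')\in X\big].$$ **Abstraction.** Let $Q_{\rm safe}$ be a finite partition of $X$ into nonempty measurable regions $q$, each with $q\cap X_{\rm tgt}=\emptyset$ or $q\cap (X\setminus X_{\rm tgt})=\emptyset$; let $Q_{\rm tgt}=\{q\in Q_{\rm safe}: q\cap X_{\rm tgt}=q\}$, $q_u=\mathbb R^n\setminus X$, $Q=Q_{\rm safe}\cup\{q_u\}$, and $A=U$. Let $\underline P,\overline P$ be interval MDP bounds, i.e. $0\le\underline P(q,a,q')\le\overline P(q,a,q')\le1$ and $\sum_{q'}\underline P(q,a,q')\le1\le\sum_{q'}\overline P(q,a,q')$ for all $q\in Q$, $a\in A$, such that $\underline P(q,a,q')\le T^a_{\widehat p_v}(q'\mid x)\le\overline P(q,a,q')$ for all $q\in Q_{\rm safe}$, $x\in q$, $a\in A$, $q'\in Q$, and $\underline P(q_u,a,q_u)=\overline P(q_u,a,q_u)=1$. Let $\widehat\Gamma_{q,a}$ be the set of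 probability distributions $\gamma$ on $Q$ with $\underline P(q,a,\cdot)\le\gamma\le\overline P(q,a,\cdot)$. With the cost $c(q,q')=\inf\{\|x-y\|^s:x\in q,\,y\in q'\}$ and the optimal transport discrepancy $\mathcal T_c$ on distributions over $Q$, let $\Gamma_{q,a}=\{\gamma:\ \mathcal T_c(\widehat\gamma,\gamma)\le\varepsilon^s\text{ for some }\widehat\gamma\in\widehat\Gamma_{q,a}\}$ for $q\in Q_{\rm safe}$, and $\Gamma_{q_u,a}=\widehat\Gamma_{q_u,a}$. The robust MDP abstraction is $\mathcal M=(Q,A,\Gamma)$. A strategy $\sigma$ of $\mathcal M$ maps finite paths $\omega^k=q_0\xrightarrow{a_0}\cdots\xrightarrow{a_{k-1}}q_k$ to actions; an adversary $\xi\in\Xi$ maps a finite path with last state $q$ and an action $a$ to an element of $\Gamma_{q,a}$; $\sigma$, $\xi$ and an initial state determine a law on state sequences, and $P_{\rm reach}(Q_{\rm safe},Q_{\rm tgt},K\mid q,\sigma,\xi)$ is defined as above. A strategy $\sigma^*$ is optimal if it maximizes $\inf_{\xi\in\Xi}P_{\rm reach}(Q_{\rm safe},Q_{\rm tgt},K\mid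 q,\sigma,\xi)$ over all strategies $\sigma$, for every $q\in Q$. For such a $\sigma^*$ put $$\underline p^K(q)=\inf_{\xi\in\Xi}P_{\rm reach}(Q_{\rm safe},Q_{\rm tgt},K\mid q,\sigma^*,\xi),\qquad \overline p^K(q)=\sup_{\xi\in\Xi}P_{\rm reach}(Q_{\rm safe},Q_{\rm tgt},K\mid q,\sigma^*,\xi).$$ **Theorem (Correctness).** Let $\sigma^*$ be an optimal strategy of $\mathcal M$, let $J:\mathbb R^n\to Q$ be given by $J(x)=q\iff x\in q$, and let $\sigma_x^*$ be the switching strategy $$\sigma_x^*\big(x_0\xrightarrow{u_0}\cdots\xrightarrow{u_{k-1}}x_k\big)=\sigma^*\big(J(x_0)\xrightarrow{u_0}\cdots\xrightarrow{u_{k-1}}J(x_k)\big).$$ Then, for every $q\in Q$, $x\in q$ and $p_v\in\mathcal P_v$, $$\underline p^K(q)\ \le\ P_{\rm reach}(X,X_{\rm tgt},K\mid x,\sigma_x^*,p_v)\ \le\ \overline p^K(q).$$ -/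

import Mathlib

open MeasureTheory ProbabilityTheory
open scoped ENNReal NNReal

noncomputable section

/-! ### Optimal transport -/

/-- Transport plans (couplings) between two probability distributions. -/
def transportPlans {S : Type*} [MeasurableSpace S] (p p' : ProbabilityMeasure S) :
    Set (ProbabilityMeasure (S × S)) :=
  {π | (π : Measure (S × S)).map Prod.fst = (p : Measure S) ∧
    (π : Measure (S × S)).map Prod.snd = (p' : Measure S)}

/-- Optimal transport discrepancy `𝒯_c(p, p')` for a nonnegative (extended) cost `c`. -/
def transportDiscrepancy {S : Type*} [MeasurableSpace S] (c : S → S → ℝ≥0∞)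
    (p p' : ProbabilityMeasure S) : ℝ≥0∞ :=
  ⨅ π ∈ transportPlans p p', ∫⁻ z, c z.1 z.2 ∂(π : Measure (S × S))

/-- Distributions to which mass can be transported from `γ` at cost at most `e`. -/
def transportBall {S : Type*} [MeasurableSpace S] (c : S → S → ℝ≥0∞) (e : ℝ≥0∞)
    (γ : ProbabilityMeasure S) : Set (ProbabilityMeasure S) :=
  {γ' | transportDiscrepancy c γ γ' ≤ e}

/-- The `s`-Wasserstein distance `(𝒯_{d^s})^{1/s}`. -/
def wasserstein {S : Type*} [MetricSpace S] [MeasurableSpace S] (s : ℝ)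
    (p p' : ProbabilityMeasure S) : ℝ≥0∞ :=
  transportDiscrepancy (fun x y => edist x y ^ s) p p' ^ (1 / s)

/-- Probability distributions with finite `s`-th moment. -/
def finiteMoment (S : Type*) [MetricSpace S] [MeasurableSpace S] (s : ℝ) :
    Set (ProbabilityMeasure S) :=
  {p | ∃ y : S, ∫⁻ x, edist x y ^ s ∂(p : Measure S) < ∞}

/-- The Wasserstein ambiguity set of radius `ε` around `pnom`. -/
def ambiguitySet {S : Type*} [MetricSpace S] [MeasurableSpace S] (s ε : ℝ)
    (pnom : ProbabilityMeasure S) : Set (ProbabilityMeasure S) :=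
  {p | p ∈ finiteMoment S s ∧ wasserstein s p pnom ≤ ENNReal.ofReal ε}

/-! ### Finite paths, strategies, and the law of a controlled process -/

/-- A finite path `x₀ -u₀→ x₁ -u₁→ ⋯ -u_{k-1}→ x_k`: its length `k`, its states, its actions. -/
abbrev FinPath (S A : Type*) := Σ k : ℕ, (Fin (k + 1) → S) × (Fin k → A)

namespace FinPath

variable {S S' A : Type*}

/-- The last state of a finite path. -/
def last (ω : FinPath S A) : S := ω.2.1 (Fin.last ω.1)

/-- Apply a map to all the states of a finite path, keeping the actions. -/
def map (J : S → S') (ω : FinPath S A) : FinPath S' A := ⟨ω.1, fun i => J (ω.2.1 i), ω.2.2⟩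

end FinPath

/-- A strategy maps each finite path to an action. -/
abbrev Strategy (S A : Type*) := FinPath S A → A

/-- The actions `u₀, …, u_{k-1}` taken by the strategy `σ` along the states `x₀, …, x_k`. -/
def Strategy.actions {S A : Type*} (σ : Strategy S A) : (k : ℕ) → (Fin (k + 1) → S) → (Fin k → A)
  | 0, _ => Fin.elim0
  | k + 1, x => Fin.snoc (α := fun _ => A) (Strategy.actions σ k (Fin.init x))
      (σ ⟨k, Fin.init x, Strategy.actions σ k (Fin.init x)⟩)

/-- The finite path with states `x₀, …, x_k` generated under the strategy `σ`. -/
def Strategy.path {S A : Type*} (σ : Strategy S A) (k : ℕ) (x : Fin (k + 1) → S) : FinPath S A :=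
  ⟨k, x, σ.actions k x⟩

theorem measurable_sigma_mk {I : Type*} {β : I → Type*} [∀ i, MeasurableSpace (β i)] (i : I) :
    Measurable (Sigma.mk i : β i → Sigma β) := by
  rw [measurable_iff_le_map]
  exact iInf_le _ i

theorem measurable_of_sigma {I : Type*} {β : I → Type*} {T : Type*} [∀ i, MeasurableSpace (β i)]
    [MeasurableSpace T] {f : Sigma β → T} (h : ∀ i, Measurable fun b : β i => f ⟨i, b⟩) :
    Measurable f := by
  intro t ht
  refine (MeasurableSpace.measurableSet_iInf).2 fun i => ?_
  exact h i ht

theorem FinPath.measurable_last {S A : Type*} [MeasurableSpace S] [MeasurableSpace A] :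
    Measurable (FinPath.last : FinPath S A → S) :=
  measurable_of_sigma fun k => (measurable_pi_apply (Fin.last k)).comp measurable_fst

theorem FinPath.measurable_map {S S' A : Type*} [MeasurableSpace S] [MeasurableSpace S']
    [MeasurableSpace A] {J : S → S'} (hJ : Measurable J) :
    Measurable (FinPath.map J : FinPath S A → FinPath S' A) := by
  refine measurable_of_sigma fun k => ?_
  refine (measurable_sigma_mk k).comp (Measurable.prodMk ?_ measurable_snd)
  exact measurable_pi_lambda _ fun i => hJ.comp ((measurable_pi_apply i).comp measurable_fst)

theorem Strategy.measurable_actions {S A : Type*} [MeasurableSpace S] [MeasurableSpace A]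
    {σ : Strategy S A} (hσ : Measurable σ) (k : ℕ) : Measurable (σ.actions k) := by
  induction k with
  | zero => exact measurable_pi_lambda _ fun i => i.elim0
  | succ k ih =>
    have hinit : Measurable (fun x : Fin (k + 2) → S => (Fin.init x : Fin (k + 1) → S)) :=
      measurable_pi_lambda _ fun i => measurable_pi_apply _
    have hact := ih.comp hinit
    refine measurable_pi_lambda _ fun i => ?_
    refine Fin.lastCases ?_ (fun j => ?_) i
    · simp only [Strategy.actions, Fin.snoc_last]
      exact hσ.comp ((measurable_sigma_mk k).comp (hinit.prodMk hact))
    · simp only [Strategy.actions, Fin.snoc_castSucc]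
      exact (measurable_pi_apply j).comp hact

theorem Strategy.measurable_path {S A : Type*} [MeasurableSpace S] [MeasurableSpace A]
    {σ : Strategy S A} (hσ : Measurable σ) (k : ℕ) : Measurable (σ.path k) :=
  (measurable_sigma_mk k).comp (measurable_id.prodMk (Strategy.measurable_actions hσ k))

/-- The law of `x_{k+1}` given `x₀, …, x_k`, when actions are chosen by `σ` and the next state is
drawn from `κ (ω, u)` after the finite path `ω` and the action `u`. -/
def stepKernel {S A : Type*} [MeasurableSpace S] [MeasurableSpace A] (σ : Strategy S A)
    (hσ : Measurable σ) (κ : Kernel (FinPath S A × A) S) (k : ℕ) :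
    Kernel (Finset.Iic k → S) S :=
  κ.comap
    (fun h =>
      (σ.path k (fun i => h ⟨i, Finset.mem_Iic.2 (Nat.lt_succ_iff.1 i.2)⟩),
        σ (σ.path k (fun i => h ⟨i, Finset.mem_Iic.2 (Nat.lt_succ_iff.1 i.2)⟩))))
    (by
      have h : Measurable fun h : Finset.Iic k → S =>
          σ.path k (fun i => h ⟨i, Finset.mem_Iic.2 (Nat.lt_succ_iff.1 i.2)⟩) :=
        (Strategy.measurable_path hσ k).comp
          (measurable_pi_lambda _ fun i => measurable_pi_apply _)
      exact h.prodMk (hσ.comp h))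

instance {S A : Type*} [MeasurableSpace S] [MeasurableSpace A] (σ : Strategy S A)
    (hσ : Measurable σ) (κ : Kernel (FinPath S A × A) S) [IsMarkovKernel κ] (k : ℕ) :
    IsMarkovKernel (stepKernel σ hσ κ k) := by
  unfold stepKernel; infer_instance

/-- The law, given by the Ionescu-Tulcea theorem, of the state sequence of the process started at
`x₀`, controlled by `σ`, with transitions `κ`. -/
def pathLaw {S A : Type*} [MeasurableSpace S] [MeasurableSpace A] (σ : Strategy S A)
    (hσ : Measurable σ) (κ : Kernel (FinPath S A × A) S) [IsMarkovKernel κ] (x₀ : S) :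
    Measure (ℕ → S) :=
  Kernel.traj (X := fun _ => S) (stepKernel σ hσ κ) 0 (fun _ => x₀)

/-- The state sequences that reach `tgt` at some time `k ≤ K`, staying in `safe` before `k`. -/
def reachAvoid {S : Type*} (safe tgt : Set S) (K : ℕ∞) : Set (ℕ → S) :=
  {ω | ∃ k : ℕ, (k : ℕ∞) ≤ K ∧ ω k ∈ tgt ∧ ∀ k' < k, ω k' ∈ safe}

/-! ### Switched stochastic systems -/

/-- The noise-free part of the system `x_{k+1} = f_{u_k}(x_k) + v_k` on `ℝⁿ` with `m` modes. -/
structure SwitchedSystem (n m : ℕ) where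
  f : Fin m → EuclideanSpace ℝ (Fin n) → EuclideanSpace ℝ (Fin n)
  continuous_f : ∀ u, Continuous (f u)

/-- A (measurable) switching strategy. -/
structure SwitchingStrategy (n m : ℕ) where
  toFun : Strategy (EuclideanSpace ℝ (Fin n)) (Fin m)
  measurable_toFun : Measurable toFun

namespace SwitchedSystem

variable {n m : ℕ} (sys : SwitchedSystem n m)

/-- `T^u_p(· ∣ x)`: the law of `f_u(x) + v` for `v` distributed according to `p`. -/
def transition (p : ProbabilityMeasure (EuclideanSpace ℝ (Fin n))) (u : Fin m)
    (x : EuclideanSpace ℝ (Fin n)) : Measure (EuclideanSpace ℝ (Fin n)) :=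
  (p : Measure (EuclideanSpace ℝ (Fin n))).map fun v => sys.f u x + v

theorem measurable_uncurry_f :
    Measurable fun z : EuclideanSpace ℝ (Fin n) × Fin m => sys.f z.2 z.1 :=
  measurable_from_prod_countable_left fun u => (sys.continuous_f u).measurable

/-- The transition kernel of the system, as a function of the finite path and of the mode. -/
def kernel (p : ProbabilityMeasure (EuclideanSpace ℝ (Fin n))) :
    Kernel (FinPath (EuclideanSpace ℝ (Fin n)) (Fin m) × Fin m) (EuclideanSpace ℝ (Fin n)) where
  toFun z := sys.transition p z.2 z.1.last
  measurable' := by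
    have h1 : Measurable fun z : FinPath (EuclideanSpace ℝ (Fin n)) (Fin m) × Fin m =>
        sys.f z.2 z.1.last :=
      sys.measurable_uncurry_f.comp
        ((FinPath.measurable_last.comp measurable_fst).prodMk measurable_snd)
    refine Measure.measurable_of_measurable_coe _ fun B hB => ?_
    have h2 : MeasurableSet {y : (FinPath (EuclideanSpace ℝ (Fin n)) (Fin m) × Fin m) ×
        EuclideanSpace ℝ (Fin n) | sys.f y.1.2 y.1.1.last + y.2 ∈ B} :=
      ((h1.comp measurable_fst).add measurable_snd) hB
    have h3 := measurable_measure_prodMk_left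
      (ν := (p : Measure (EuclideanSpace ℝ (Fin n)))) h2
    convert h3 using 2 with z
    rw [transition, Measure.map_apply (measurable_const_add _) hB]
    rfl

instance (p : ProbabilityMeasure (EuclideanSpace ℝ (Fin n))) : IsMarkovKernel (sys.kernel p) :=
  ⟨fun _ => Measure.isProbabilityMeasure_map (measurable_const_add _).aemeasurable⟩

/-- `P_reach(X, X_tgt, K ∣ x₀, σ, p)` for the system. -/
def reachProb (X Xtgt : Set (EuclideanSpace ℝ (Fin n))) (K : ℕ∞)
    (x₀ : EuclideanSpace ℝ (Fin n)) (σ : SwitchingStrategy n m)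
    (p : ProbabilityMeasure (EuclideanSpace ℝ (Fin n))) : ℝ≥0∞ :=
  pathLaw σ.toFun σ.measurable_toFun (sys.kernel p) x₀ (reachAvoid X Xtgt K)

end SwitchedSystem

/-! ### Robust MDPs -/

instance {S A : Type*} [Countable S] [Countable A] [MeasurableSpace S] [MeasurableSpace A]
    [DiscreteMeasurableSpace S] [DiscreteMeasurableSpace A] :
    DiscreteMeasurableSpace (FinPath S A) :=
  ⟨fun B => measurableSet_setOfPred.2
    (measurable_of_sigma (f := fun ω : FinPath S A => ω ∈ B) fun _ => Measurable.of_discrete)⟩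

/-- A robust MDP with states `Q` and actions `A`, all actions being available at all states. -/
structure RobustMDP (Q A : Type*) [MeasurableSpace Q] where
  Γ : Q → A → Set (ProbabilityMeasure Q)

namespace RobustMDP

variable {Q A : Type*} [Finite Q] [MeasurableSpace Q] [DiscreteMeasurableSpace Q]
  [Finite A] [MeasurableSpace A] [DiscreteMeasurableSpace A]

/-- An adversary assigns an admissible distribution to each finite path and action. -/
structure Adversary {Q A : Type*} [MeasurableSpace Q] (M : RobustMDP Q A) where
  toFun : FinPath Q A → A → ProbabilityMeasure Q
  mem_Γ : ∀ ω a, toFun ω a ∈ M.Γ ω.last a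

/-- The transition kernel chosen by an adversary. -/
def Adversary.kernel {M : RobustMDP Q A} (ξ : M.Adversary) : Kernel (FinPath Q A × A) Q where
  toFun z := (ξ.toFun z.1 z.2 : Measure Q)
  measurable' := Measurable.of_discrete

instance {M : RobustMDP Q A} (ξ : M.Adversary) : IsMarkovKernel ξ.kernel :=
  ⟨fun z => inferInstanceAs (IsProbabilityMeasure (ξ.toFun z.1 z.2 : Measure Q))⟩

/-- `P_reach(safe, tgt, K ∣ q, σ, ξ)` for the robust MDP. -/
def reachProb (M : RobustMDP Q A) (safe tgt : Set Q) (K : ℕ∞) (q : Q) (σ : Strategy Q A)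
    (ξ : M.Adversary) : ℝ≥0∞ :=
  pathLaw σ Measurable.of_discrete ξ.kernel q (reachAvoid safe tgt K)

/-- Worst-case reach-avoid probability under `σ`. -/
def lowerBound (M : RobustMDP Q A) (safe tgt : Set Q) (K : ℕ∞) (σ : Strategy Q A) (q : Q) :
    ℝ≥0∞ :=
  ⨅ ξ : M.Adversary, M.reachProb safe tgt K q σ ξ

/-- Best-case reach-avoid probability under `σ`. -/
def upperBound (M : RobustMDP Q A) (safe tgt : Set Q) (K : ℕ∞) (σ : Strategy Q A) (q : Q) :
    ℝ≥0∞ :=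
  ⨆ ξ : M.Adversary, M.reachProb safe tgt K q σ ξ

/-- `σ` maximizes the worst-case reach-avoid probability, simultaneously for all initial states. -/
def IsOptimal (M : RobustMDP Q A) (safe tgt : Set Q) (K : ℕ∞) (σ : Strategy Q A) : Prop :=
  ∀ (q : Q) (σ' : Strategy Q A), M.lowerBound safe tgt K σ' q ≤ M.lowerBound safe tgt K σ q

end RobustMDP

/-- Transition probability bounds of an interval MDP. -/
structure IntervalMDP (Q A : Type*) [Fintype Q] where
  lower : Q → A → Q → ℝ
  upper : Q → A → Q → ℝ
  lower_nonneg : ∀ q a q', 0 ≤ lower q a q'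
  lower_le_upper : ∀ q a q', lower q a q' ≤ upper q a q'
  upper_le_one : ∀ q a q', upper q a q' ≤ 1
  sum_lower_le_one : ∀ q a, ∑ q', lower q a q' ≤ 1
  one_le_sum_upper : ∀ q a, 1 ≤ ∑ q', upper q a q'

/-- The robust MDP given by an interval MDP. -/
def IntervalMDP.toRobustMDP {Q A : Type*} [Fintype Q] [MeasurableSpace Q] (I : IntervalMDP Q A) :
    RobustMDP Q A where
  Γ q a := {γ | ∀ q', I.lower q a q' ≤ (γ {q'} : ℝ) ∧ (γ {q'} : ℝ) ≤ I.upper q a q'}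

/-! ### The abstraction -/

/-- A finite partition of the safe set `X` into nonempty measurable regions, each of them either
disjoint from `X_tgt` or disjoint from `X \ X_tgt`. -/
structure SafePartition {n : ℕ} (X Xtgt : Set (EuclideanSpace ℝ (Fin n))) (ι : Type*) where
  cell : ι → Set (EuclideanSpace ℝ (Fin n))
  measurableSet_cell : ∀ i, MeasurableSet (cell i)
  nonempty_cell : ∀ i, (cell i).Nonempty
  disjoint_cell : ∀ i j, i ≠ j → Disjoint (cell i) (cell j)
  iUnion_cell : ⋃ i, cell i = X
  respects : ∀ i, cell i ∩ Xtgt = ∅ ∨ cell i ∩ (X \ Xtgt) = ∅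

/-- States of the abstraction: `some i` is the `i`-th safe region, `none` the unsafe region. -/
abbrev AbsState (ι : Type*) := Option ι

instance (ι : Type*) : MeasurableSpace (AbsState ι) := ⊤

instance (ι : Type*) : DiscreteMeasurableSpace (AbsState ι) := ⟨fun _ => trivial⟩

namespace SafePartition

variable {n m : ℕ} {X Xtgt : Set (EuclideanSpace ℝ (Fin n))} {ι : Type*}
  (part : SafePartition X Xtgt ι)

/-- The region of `ℝⁿ` that a state of the abstraction stands for. -/
def region : AbsState ι → Set (EuclideanSpace ℝ (Fin n))
  | some i => part.cell i
  | none => Xᶜ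

/-- The states `Q_safe`. -/
def safe (_part : SafePartition X Xtgt ι) : Set (AbsState ι) := Set.range some

/-- The states `Q_tgt`. -/
def target : Set (AbsState ι) := {q | q ∈ part.safe ∧ part.region q ∩ Xtgt = part.region q}

theorem existsUnique_region (x : EuclideanSpace ℝ (Fin n)) : ∃! q, x ∈ part.region q := by
  by_cases hx : x ∈ X
  · obtain ⟨i, hi⟩ := Set.mem_iUnion.1 (part.iUnion_cell.symm ▸ hx)
    refine ⟨some i, hi, ?_⟩
    rintro (_ | j) hj
    · exact absurd hx hj
    · by_contra hne
      exact Set.disjoint_left.1 (part.disjoint_cell j i fun h => hne (by rw [h])) hj hi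
  · refine ⟨none, hx, ?_⟩
    rintro (_ | j) hj
    · rfl
    · exact absurd (part.iUnion_cell ▸ Set.mem_iUnion.2 ⟨j, hj⟩) hx

/-- The map `J` from a point of `ℝⁿ` to the state of the abstraction whose region contains it. -/
def J (x : EuclideanSpace ℝ (Fin n)) : AbsState ι := (part.existsUnique_region x).choose

theorem J_eq_iff (x : EuclideanSpace ℝ (Fin n)) (q : AbsState ι) :
    part.J x = q ↔ x ∈ part.region q := by
  have h := (part.existsUnique_region x).choose_spec
  exact ⟨fun e => e ▸ h.1, fun hq => (h.2 q hq).symm⟩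

theorem measurableSet_region [Finite ι] (q : AbsState ι) : MeasurableSet (part.region q) := by
  cases q with
  | some i => exact part.measurableSet_cell i
  | none =>
    have h : MeasurableSet X := by
      rw [← part.iUnion_cell]; exact MeasurableSet.iUnion part.measurableSet_cell
    exact h.compl

theorem measurable_J [Finite ι] : Measurable part.J := by
  refine measurable_to_countable' fun q => ?_
  have : part.J ⁻¹' {q} = part.region q := by
    ext x; simp [part.J_eq_iff]
  rw [this]; exact part.measurableSet_region q

/-- The refinement `σ_x(ω) = σ(J(ω))` of a strategy of the abstraction. -/
def refine [Finite ι] (σ : Strategy (AbsState ι) (Fin m)) : SwitchingStrategy n m where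
  toFun ω := σ (ω.map part.J)
  measurable_toFun :=
    (Measurable.of_discrete (f := σ)).comp (FinPath.measurable_map part.measurable_J)

/-- The cost `c(q, q') = inf {‖x - y‖^s : x ∈ q, y ∈ q'}`. -/
def cost (s : ℝ) (q q' : AbsState ι) : ℝ≥0∞ :=
  ⨅ x ∈ part.region q, ⨅ y ∈ part.region q', edist x y ^ s

/-- `I` is a nominal interval MDP abstraction: its bounds are valid for the nominal noise at every
point of every safe region, and the unsafe state is absorbing. -/
def IsNominalAbstraction [Fintype ι] (sys : SwitchedSystem n m)
    (pnom : ProbabilityMeasure (EuclideanSpace ℝ (Fin n)))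
    (I : IntervalMDP (AbsState ι) (Fin m)) : Prop :=
  (∀ (i : ι) (a : Fin m) (q' : AbsState ι), ∀ x ∈ part.region (some i),
    I.lower (some i) a q' ≤ (sys.transition pnom a x).real (part.region q') ∧
      (sys.transition pnom a x).real (part.region q') ≤ I.upper (some i) a q') ∧
  ∀ a : Fin m, I.lower none a none = 1 ∧ I.upper none a none = 1

/-- The robust MDP abstraction: at safe states, the distributions at transport discrepancy at most
`ε^s` from the nominal ones; the unsafe state is left unchanged. -/
def robustAbstraction [Fintype ι] (s ε : ℝ) (I : IntervalMDP (AbsState ι) (Fin m)) :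
    RobustMDP (AbsState ι) (Fin m) where
  Γ q a :=
    match q with
    | some i => ⋃ γ ∈ I.toRobustMDP.Γ (some i) a,
        transportBall (part.cost s) (ENNReal.ofReal (ε ^ s)) γ
    | none => I.toRobustMDP.Γ none a

end SafePartition

end

noncomputable section

open Preorder

/-! ### Laws of controlled processes -/

section PathLaw

variable {S A : Type*} [MeasurableSpace S] [MeasurableSpace A]

/-! The abstract process `J (ω k)` is in general not Markov, but an adversary may depend on the
whole history, and this freedom suffices to imitate the system exactly. Fix the noise law `p` and
condition the true path law on the abstract prefix `y 0, …, y k`, ending in a safe region. The state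
`ω k` then has some law `ν` carried by that region, and the next abstract state has the averaged law
`stepLaw sys p ν u`. The adversary plays this average.

The move is admissible for two reasons. With nominal noise, the interval bounds hold at every point
of the region, hence for the average over `ν` (`stepLaw_mem_nominal`). To pass from nominal to true
noise, use the same current state for both and couple only the noises: the successors differ by
exactly the noise difference, so the abstract transport cost is at most the `s`-th power of the
Wasserstein distance (`transportDiscrepancy_stepLaw_le`).

By induction on the length, both laws then agree on every cylinder whose states before the last are
safe (`pathLaw_cylinder_eq`). The restriction is needed because the system may re-enter `X` while
the abstract unsafe state is absorbing, and it is harmless because reach-avoid events are countable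
disjoint unions of such cylinders. The system's probability is therefore attained by one adversary,
and so lies between the infimum and the supremum. -/

instance (σ : Strategy S A) (hσ : Measurable σ) (κ : Kernel (FinPath S A × A) S)
    [IsMarkovKernel κ] (x₀ : S) : IsProbabilityMeasure (pathLaw σ hσ κ x₀) := by
  unfold pathLaw; infer_instance

/-- The states `ω 0, …, ω k` of a state sequence. -/
def statePrefix (k : ℕ) (ω : ℕ → S) : Fin (k + 1) → S := fun i => ω i

theorem measurable_statePrefix (k : ℕ) : Measurable (statePrefix k : (ℕ → S) → Fin (k + 1) → S) :=
  measurable_pi_lambda _ fun _ => measurable_pi_apply _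

theorem pathLaw_map_zero (σ : Strategy S A) (hσ : Measurable σ) (κ : Kernel (FinPath S A × A) S)
    [IsMarkovKernel κ] (x₀ : S) :
    (pathLaw σ hσ κ x₀).map (fun ω => ω 0) = Measure.dirac x₀ := by
  have h := Kernel.traj_map_frestrictLe_apply (X := fun _ => S) (κ := stepKernel σ hσ κ) 0 0
    (fun _ => x₀)
  rw [Kernel.partialTraj_self, Kernel.id_apply] at h
  have hm : Measurable fun y : Finset.Iic 0 → S => y ⟨0, Finset.mem_Iic.2 le_rfl⟩ :=
    measurable_pi_apply _
  have h' := congrArg (Measure.map fun y : Finset.Iic 0 → S => y ⟨0, Finset.mem_Iic.2 le_rfl⟩) h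
  rwa [Measure.map_map hm (measurable_frestrictLe 0), Measure.map_dirac' hm] at h'

/-- The Markov-type property of the law of a controlled process. -/
theorem pathLaw_succ (σ : Strategy S A) (hσ : Measurable σ) (κ : Kernel (FinPath S A × A) S)
    [IsMarkovKernel κ] (x₀ : S) (k : ℕ) {B : Set (Fin (k + 1) → S)} (hB : MeasurableSet B)
    {D : Set S} (hD : MeasurableSet D) :
    pathLaw σ hσ κ x₀ (statePrefix k ⁻¹' B ∩ {ω | ω (k + 1) ∈ D}) =
      ∫⁻ ω in statePrefix k ⁻¹' B,
        κ (σ.path k (statePrefix k ω), σ (σ.path k (statePrefix k ω))) D ∂pathLaw σ hσ κ x₀ := by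
  let e : (Finset.Iic k → S) → (Fin (k + 1) → S) :=
    fun h i => h ⟨i, Finset.mem_Iic.2 (Nat.lt_succ_iff.1 i.2)⟩
  have he : Measurable e := measurable_pi_lambda _ fun _ => measurable_pi_apply _
  -- The joint law of the prefix and the next state is the prefix law composed with the step kernel;
  -- evaluating it on a rectangle gives the claim. The map `e` only reindexes `Finset.Iic k` by `Fin
  -- (k + 1)`.
  have h := Kernel.partialTraj_compProd_eq_map_traj (X := fun _ => S) (κ := stepKernel σ hσ κ)
    (Nat.zero_le k) (x₀ := fun _ => x₀)
  have h' := congrArg (fun μ => μ ((e ⁻¹' B) ×ˢ D)) h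
  rw [Measure.compProd_apply_prod (he hB) hD,
    Measure.map_apply ((measurable_frestrictLe k).prodMk (measurable_pi_apply _))
      ((he hB).prod hD), ← Kernel.traj_map_frestrictLe_apply,
    setLIntegral_map (he hB) (Kernel.measurable_coe _ hD) (measurable_frestrictLe k)] at h'
  exact h'.symm

end PathLaw

/-! ### Reach-avoid events -/

/-- Decomposition by the first hitting time of `tgt`. Requiring earlier states to lie outside `tgt`
makes the pieces disjoint, so that probabilities can be summed. -/
theorem reachAvoid_eq_iUnion {Q : Type*} (safe tgt : Set Q) (K : ℕ∞) :
    reachAvoid safe tgt K =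
      ⋃ z : {z : Σ k : ℕ, (Fin (k + 1) → Q) // (z.1 : ℕ∞) ≤ K ∧ z.2 (Fin.last z.1) ∈ tgt ∧
        ∀ i : Fin z.1, z.2 i.castSucc ∈ safe \ tgt}, statePrefix z.1.1 ⁻¹' {z.1.2} := by
  classical
  ext ω
  simp only [Set.mem_iUnion]
  constructor
  · rintro ⟨k, hk, hkt, hks⟩
    have hex : ∃ k, ω k ∈ tgt := ⟨k, hkt⟩
    have hle : Nat.find hex ≤ k := Nat.find_min' hex hkt
    exact ⟨⟨⟨Nat.find hex, statePrefix _ ω⟩, le_trans (by exact_mod_cast hle) hk,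
      Nat.find_spec hex, fun i => ⟨hks _ (lt_of_lt_of_le i.2 hle), Nat.find_min hex i.2⟩⟩, rfl⟩
  · rintro ⟨⟨⟨k, h⟩, hK, ht, hs⟩, hω⟩
    obtain rfl : statePrefix k ω = h := hω
    exact ⟨k, hK, ht, fun k' hk' => (hs ⟨k', hk'⟩).1⟩

theorem measure_reachAvoid_congr {Q : Type*} [Countable Q] [MeasurableSpace Q]
    [DiscreteMeasurableSpace Q] {μ ν : Measure (ℕ → Q)} {safe : Set Q} (tgt : Set Q) (K : ℕ∞)
    (h : ∀ (k : ℕ) (y : Fin (k + 1) → Q), (∀ i : Fin k, y i.castSucc ∈ safe) →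
      μ (statePrefix k ⁻¹' {y}) = ν (statePrefix k ⁻¹' {y})) :
    μ (reachAvoid safe tgt K) = ν (reachAvoid safe tgt K) := by
  rw [reachAvoid_eq_iUnion, measure_iUnion, measure_iUnion]
  · exact tsum_congr fun z => h _ _ fun i => (z.2.2.2 i).1
  all_goals try exact fun z => measurable_statePrefix _ (measurableSet_singleton _)
  all_goals
    rintro ⟨⟨k, y⟩, hK, ht, hs⟩ ⟨⟨k', y'⟩, hK', ht', hs'⟩ hne
    refine Set.disjoint_left.2 fun ω h1 h2 => hne ?_
    obtain rfl : statePrefix k ω = y := h1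
    obtain rfl : statePrefix k' ω = y' := h2
    -- Two pieces of different lengths cannot share a sequence: the longer one forbids `tgt` at the
    -- hitting time of the shorter.
    rcases lt_trichotomy k k' with hlt | rfl | hlt
    · exact absurd ht (hs' ⟨k, hlt⟩).2
    · rfl
    · exact absurd ht' (hs ⟨k', hlt⟩).2

theorem statePrefix_preimage_singleton_succ {Q : Type*} (k : ℕ) (y : Fin (k + 2) → Q) :
    statePrefix (k + 1) ⁻¹' {y} = statePrefix k ⁻¹' {Fin.init y} ∩
      {ω | ω (k + 1) ∈ ({y (Fin.last (k + 1))} : Set Q)} := by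
  ext ω
  simp only [statePrefix, Set.mem_preimage, Set.mem_ofPred_eq, Set.mem_inter_iff,
    Set.mem_singleton_iff, funext_iff, Fin.forall_fin_succ' (n := k + 1), Fin.init, Fin.val_last,
    Fin.val_castSucc]

/-! ### Paths under the refined strategy -/

/-- The refined strategy sees only abstract states, so its actions are constant on each cylinder of
abstract prefixes. -/
theorem Strategy.actions_comp_map {S S' A : Type*} (J : S → S') (σ : Strategy S' A) (k : ℕ)
    (x : Fin (k + 1) → S) :
    Strategy.actions (fun ω => σ (FinPath.map J ω)) k x = σ.actions k (fun i => J (x i)) := by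
  induction k with
  | zero => rfl
  | succ k ih =>
    rw [Strategy.actions, ih]
    rfl

theorem Strategy.map_path_comp_map {S S' A : Type*} (J : S → S') (σ : Strategy S' A) (k : ℕ)
    (x : Fin (k + 1) → S) :
    (Strategy.path (fun ω => σ (FinPath.map J ω)) k x).map J = σ.path k (fun i => J (x i)) := by
  rw [Strategy.path, Strategy.actions_comp_map]
  rfl

theorem SwitchedSystem.measurable_step {n m : ℕ} (sys : SwitchedSystem n m) (u : Fin m) :
    Measurable fun z : EuclideanSpace ℝ (Fin n) × EuclideanSpace ℝ (Fin n) =>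
      sys.f u z.1 + z.2 :=
  ((sys.continuous_f u).measurable.comp measurable_fst).add measurable_snd

/-! ### The quotient map `J`, reach-avoid events and abstract cylinders -/

namespace SafePartition

variable {n m : ℕ} {X Xtgt : Set (EuclideanSpace ℝ (Fin n))} {ι : Type*}
  (part : SafePartition X Xtgt ι) (sys : SwitchedSystem n m)

theorem J_mem_safe_iff (x : EuclideanSpace ℝ (Fin n)) : part.J x ∈ part.safe ↔ x ∈ X := by
  have h := part.J_eq_iff x none
  rw [← not_iff_not, safe, Set.mem_range]
  cases hJ : part.J x <;> simp_all [region]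

theorem J_mem_target_iff (hXtgt : Xtgt ⊆ X) (x : EuclideanSpace ℝ (Fin n)) :
    part.J x ∈ part.target ↔ x ∈ Xtgt := by
  have hx : x ∈ part.region (part.J x) := (part.J_eq_iff x _).1 rfl
  constructor
  · rintro ⟨-, h⟩
    exact (h.symm ▸ hx : x ∈ part.region (part.J x) ∩ Xtgt).2
  · intro hxt
    obtain ⟨i, hi⟩ := (part.J_mem_safe_iff x).2 (hXtgt hxt)
    refine ⟨⟨i, hi⟩, Set.inter_eq_left.2 fun y hy => ?_⟩
    rw [← hi] at hx hy
    -- A cell meeting `Xtgt` cannot be the disjoint kind, so it lies inside `Xtgt`.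
    rcases part.respects i with h | h
    · exact absurd ⟨hx, hxt⟩ (Set.eq_empty_iff_forall_notMem.1 h x)
    · by_contra hyt
      exact Set.eq_empty_iff_forall_notMem.1 h y
        ⟨hy, part.iUnion_cell ▸ Set.mem_iUnion.2 ⟨i, hy⟩, hyt⟩

theorem preimage_reachAvoid (hXtgt : Xtgt ⊆ X) (K : ℕ∞) :
    (fun ω k => part.J (ω k)) ⁻¹' reachAvoid part.safe part.target K = reachAvoid X Xtgt K := by
  ext ω
  simp only [reachAvoid, Set.mem_preimage, Set.mem_ofPred_eq, part.J_mem_safe_iff,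
    part.J_mem_target_iff hXtgt]

theorem cost_J_le (s : ℝ) (x y : EuclideanSpace ℝ (Fin n)) :
    part.cost s (part.J x) (part.J y) ≤ edist x y ^ s :=
  (iInf₂_le x ((part.J_eq_iff x _).1 rfl)).trans (iInf₂_le y ((part.J_eq_iff y _).1 rfl))

/-- The state sequences whose first abstract states are `y 0, …, y k`. -/
def cylinder (k : ℕ) (y : Fin (k + 1) → AbsState ι) : Set (ℕ → EuclideanSpace ℝ (Fin n)) :=
  statePrefix k ⁻¹' {x | ∀ i, part.J (x i) = y i}

theorem cylinder_succ (k : ℕ) (y : Fin (k + 2) → AbsState ι) :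
    part.cylinder (k + 1) y = part.cylinder k (Fin.init y) ∩
      {ω | ω (k + 1) ∈ part.region (y (Fin.last (k + 1)))} := by
  ext ω
  simp only [cylinder, statePrefix, Set.mem_preimage, Set.mem_ofPred_eq, Set.mem_inter_iff,
    Fin.forall_fin_succ', part.J_eq_iff, Fin.init, Fin.val_last, Fin.val_castSucc]

/-! ### Averaged one-step laws -/

variable [Fintype ι]

theorem measurable_J_step (u : Fin m) :
    Measurable fun z : EuclideanSpace ℝ (Fin n) × EuclideanSpace ℝ (Fin n) =>
      part.J (sys.f u z.1 + z.2) :=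
  part.measurable_J.comp (sys.measurable_step u)

/-- The law of the abstract state reached in one step under mode `u` and noise law `p`, when the
current state has law `ν`. -/
def stepLaw (p ν : ProbabilityMeasure (EuclideanSpace ℝ (Fin n))) (u : Fin m) :
    ProbabilityMeasure (AbsState ι) :=
  (ν.prod p).map (part.measurable_J_step sys u).aemeasurable

theorem toMeasure_stepLaw (p ν : ProbabilityMeasure (EuclideanSpace ℝ (Fin n))) (u : Fin m) :
    (part.stepLaw sys p ν u : Measure (AbsState ι)) =
      ((ν : Measure (EuclideanSpace ℝ (Fin n))).prod
        (p : Measure (EuclideanSpace ℝ (Fin n)))).map fun z => part.J (sys.f u z.1 + z.2) :=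
  rfl

theorem stepLaw_singleton (p ν : ProbabilityMeasure (EuclideanSpace ℝ (Fin n))) (u : Fin m)
    (q : AbsState ι) :
    (part.stepLaw sys p ν u : Measure (AbsState ι)) {q} =
      ∫⁻ y, sys.transition p u y (part.region q) ∂(ν : Measure (EuclideanSpace ℝ (Fin n))) := by
  have hm := part.measurable_J_step sys u
  rw [toMeasure_stepLaw, Measure.map_apply hm (measurableSet_singleton q),
    Measure.prod_apply (hm (measurableSet_singleton q))]
  refine lintegral_congr fun y => ?_
  rw [SwitchedSystem.transition,
    Measure.map_apply (measurable_const_add _) (part.measurableSet_region q)]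
  congr 1
  ext v
  simp [part.J_eq_iff]

/-- The bounds hold pointwise on the region and are preserved by integration against a probability
measure carried by it. -/
theorem stepLaw_mem_nominal {pnom : ProbabilityMeasure (EuclideanSpace ℝ (Fin n))}
    {I : IntervalMDP (AbsState ι) (Fin m)} (hI : part.IsNominalAbstraction sys pnom I)
    (ν : ProbabilityMeasure (EuclideanSpace ℝ (Fin n))) (i : ι)
    (hν : ∀ᵐ y ∂(ν : Measure (EuclideanSpace ℝ (Fin n))), y ∈ part.region (some i)) (u : Fin m) :
    part.stepLaw sys pnom ν u ∈ I.toRobustMDP.Γ (some i) u := by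
  intro q'
  have hT : ∀ y, IsProbabilityMeasure (sys.transition pnom u y) := fun y =>
    Measure.isProbabilityMeasure_map (measurable_const_add _).aemeasurable
  have hreal : ((part.stepLaw sys pnom ν u {q'} : ℝ≥0) : ℝ) =
      ((part.stepLaw sys pnom ν u : Measure (AbsState ι)) {q'}).toReal := rfl
  have hup : 0 ≤ I.upper (some i) u q' :=
    (I.lower_nonneg _ _ _).trans (I.lower_le_upper _ _ _)
  rw [hreal]
  constructor
  · rw [← ENNReal.ofReal_le_iff_le_toReal (measure_ne_top _ _), stepLaw_singleton]
    calc ENNReal.ofReal (I.lower (some i) u q')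
        = ∫⁻ _, ENNReal.ofReal (I.lower (some i) u q')
            ∂(ν : Measure (EuclideanSpace ℝ (Fin n))) := by simp
      _ ≤ _ := lintegral_mono_ae (hν.mono fun y hy =>
          (ENNReal.ofReal_le_iff_le_toReal (measure_ne_top _ _)).2 (hI.1 i u q' y hy).1)
  · refine ENNReal.toReal_le_of_le_ofReal hup ?_
    rw [stepLaw_singleton]
    calc _ ≤ ∫⁻ _, ENNReal.ofReal (I.upper (some i) u q')
            ∂(ν : Measure (EuclideanSpace ℝ (Fin n))) := lintegral_mono_ae (hν.mono fun y hy =>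
          (ENNReal.le_ofReal_iff_toReal_le (measure_ne_top _ _) hup).2 (hI.1 i u q' y hy).2)
      _ = _ := by simp

/-- A coupling of the noises, combined with one shared current state drawn from `ν`, couples the two
successors. The common term `sys.f u z.1` cancels in the distance, and passing to regions only
lowers the cost. -/
theorem transportDiscrepancy_stepLaw_le {s : ℝ}
    (p p' ν : ProbabilityMeasure (EuclideanSpace ℝ (Fin n))) (u : Fin m) :
    transportDiscrepancy (part.cost s) (part.stepLaw sys p' ν u) (part.stepLaw sys p ν u) ≤
      transportDiscrepancy (fun x y => edist x y ^ s) p p' := by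
  refine le_iInf₂ fun π hπ => ?_
  have hm := part.measurable_J_step sys u
  have h1 : Measurable fun z : EuclideanSpace ℝ (Fin n) ×
      (EuclideanSpace ℝ (Fin n) × EuclideanSpace ℝ (Fin n)) => part.J (sys.f u z.1 + z.2.1) :=
    hm.comp (measurable_fst.prodMk (measurable_fst.comp measurable_snd))
  have h2 : Measurable fun z : EuclideanSpace ℝ (Fin n) ×
      (EuclideanSpace ℝ (Fin n) × EuclideanSpace ℝ (Fin n)) => part.J (sys.f u z.1 + z.2.2) :=
    hm.comp (measurable_fst.prodMk (measurable_snd.comp measurable_snd))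
  -- The components are swapped relative to `π`: the ambiguity set measures from `p` to the nominal
  -- law, the robust abstraction from the nominal law outwards.
  let ρ : ProbabilityMeasure (AbsState ι × AbsState ι) :=
    (ν.prod π).map (h2.prodMk h1).aemeasurable
  have hρ' : (ρ : Measure (AbsState ι × AbsState ι)) =
      ((ν : Measure (EuclideanSpace ℝ (Fin n))).prod
        (π : Measure (EuclideanSpace ℝ (Fin n) × EuclideanSpace ℝ (Fin n)))).map
        fun z => (part.J (sys.f u z.1 + z.2.2), part.J (sys.f u z.1 + z.2.1)) := rfl
  have hρ : ρ ∈ transportPlans (part.stepLaw sys p' ν u) (part.stepLaw sys p ν u) := by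
    constructor
    · rw [hρ', toMeasure_stepLaw, Measure.map_map measurable_fst (h2.prodMk h1), ← hπ.2]
      nth_rw 2 [← Measure.map_id (μ := (ν : Measure (EuclideanSpace ℝ (Fin n))))]
      rw [Measure.map_prod_map _ _ measurable_id measurable_snd,
        Measure.map_map hm (measurable_id.prodMap measurable_snd)]
      rfl
    · rw [hρ', toMeasure_stepLaw, Measure.map_map measurable_snd (h2.prodMk h1), ← hπ.1]
      nth_rw 2 [← Measure.map_id (μ := (ν : Measure (EuclideanSpace ℝ (Fin n))))]
      rw [Measure.map_prod_map _ _ measurable_id measurable_fst,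
        Measure.map_map hm (measurable_id.prodMap measurable_fst)]
      rfl
  refine (iInf₂_le ρ hρ).trans ?_
  have hd : Measurable fun w : EuclideanSpace ℝ (Fin n) × EuclideanSpace ℝ (Fin n) =>
      edist w.1 w.2 ^ s := measurable_edist.pow_const s
  calc ∫⁻ z, part.cost s z.1 z.2 ∂(ρ : Measure (AbsState ι × AbsState ι))
      = ∫⁻ z, part.cost s (part.J (sys.f u z.1 + z.2.2)) (part.J (sys.f u z.1 + z.2.1))
          ∂((ν : Measure (EuclideanSpace ℝ (Fin n))).prod
            (π : Measure (EuclideanSpace ℝ (Fin n) × EuclideanSpace ℝ (Fin n)))) :=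
        hρ' ▸ lintegral_map (f := fun z => part.cost s z.1 z.2) Measurable.of_discrete (h2.prodMk h1)
    _ ≤ ∫⁻ z, edist z.2.1 z.2.2 ^ s ∂((ν : Measure (EuclideanSpace ℝ (Fin n))).prod
            (π : Measure (EuclideanSpace ℝ (Fin n) × EuclideanSpace ℝ (Fin n)))) := by
        refine lintegral_mono fun z => (part.cost_J_le s _ _).trans_eq ?_
        rw [edist_add_left, edist_comm]
    _ = _ := (measurePreserving_snd (μ := (ν : Measure (EuclideanSpace ℝ (Fin n))))
        (ν := (π : Measure (EuclideanSpace ℝ (Fin n) × EuclideanSpace ℝ (Fin n))))).lintegral_comp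
          hd

theorem stepLaw_mem_robust {s ε : ℝ} (hs : 1 ≤ s) (hε : 0 ≤ ε)
    {pnom p : ProbabilityMeasure (EuclideanSpace ℝ (Fin n))} (hp : p ∈ ambiguitySet s ε pnom)
    {I : IntervalMDP (AbsState ι) (Fin m)} (hI : part.IsNominalAbstraction sys pnom I)
    (ν : ProbabilityMeasure (EuclideanSpace ℝ (Fin n))) (i : ι)
    (hν : ∀ᵐ y ∂(ν : Measure (EuclideanSpace ℝ (Fin n))), y ∈ part.region (some i)) (u : Fin m) :
    part.stepLaw sys p ν u ∈ (part.robustAbstraction s ε I).Γ (some i) u := by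
  have hs0 : 0 < s := zero_lt_one.trans_le hs
  refine Set.mem_iUnion₂.2 ⟨part.stepLaw sys pnom ν u,
    part.stepLaw_mem_nominal sys hI ν i hν u, ?_⟩
  refine (part.transportDiscrepancy_stepLaw_le sys p pnom ν u).trans ?_
  have h := hp.2
  rwa [wasserstein, one_div, ENNReal.rpow_inv_le_iff hs0,
    ENNReal.ofReal_rpow_of_nonneg hε hs0.le] at h

theorem dirac_none_mem_robust {s ε : ℝ} {pnom : ProbabilityMeasure (EuclideanSpace ℝ (Fin n))}
    {I : IntervalMDP (AbsState ι) (Fin m)} (hI : part.IsNominalAbstraction sys pnom I)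
    (u : Fin m) :
    (⟨Measure.dirac none, inferInstance⟩ : ProbabilityMeasure (AbsState ι)) ∈
      (part.robustAbstraction s ε I).Γ none u := by
  have hsum := I.sum_lower_le_one none u
  rw [Fintype.sum_option, (hI.2 u).1] at hsum
  -- The lower bound at `none` already uses up the total mass 1, so the other lower bounds vanish
  -- and the point mass at `none` is admissible.
  have hz : ∀ i, I.lower none u (some i) = 0 := fun i =>
    (Finset.sum_eq_zero_iff_of_nonneg fun j _ => I.lower_nonneg none u (some j)).1
      (le_antisymm (by linarith) (Finset.sum_nonneg fun j _ => I.lower_nonneg none u (some j)))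
      i (Finset.mem_univ i)
  rintro (_ | i)
  · have h : ((⟨Measure.dirac none, inferInstance⟩ : ProbabilityMeasure (AbsState ι)) :
        Measure (AbsState ι)).real {none} = 1 := by
      simp [measureReal_def]
    exact ⟨(hI.2 u).1.trans_le h.ge, h.trans_le (hI.2 u).2.ge⟩
  · have h : ((⟨Measure.dirac none, inferInstance⟩ : ProbabilityMeasure (AbsState ι)) :
        Measure (AbsState ι)).real {some i} = 0 := by
      simp [measureReal_def]
    exact ⟨(hz i).trans_le h.ge, h.trans_le
      ((I.lower_nonneg _ _ _).trans (I.lower_le_upper _ _ _))⟩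

/-! ### The adversary induced by a noise distribution -/

theorem measurableSet_prefix (k : ℕ) (y : Fin (k + 1) → AbsState ι) :
    MeasurableSet {x : Fin (k + 1) → EuclideanSpace ℝ (Fin n) | ∀ i, part.J (x i) = y i} := by
  rw [Set.ofPred_forall]
  exact MeasurableSet.iInter fun i =>
    (part.measurable_J.comp (measurable_pi_apply i)) (measurableSet_singleton (y i))

theorem measurableSet_cylinder (k : ℕ) (y : Fin (k + 1) → AbsState ι) :
    MeasurableSet (part.cylinder k y) :=
  measurable_statePrefix k (part.measurableSet_prefix k y)

/-- There is a law of the `k`-th state under `μ`, conditional on the first abstract states being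
`y 0, …, y k`. -/
theorem exists_condLaw (μ : Measure (ℕ → EuclideanSpace ℝ (Fin n))) [IsProbabilityMeasure μ]
    (k : ℕ) (y : Fin (k + 1) → AbsState ι) {i : ι} (hi : y (Fin.last k) = some i) :
    ∃ ν : ProbabilityMeasure (EuclideanSpace ℝ (Fin n)),
      (∀ᵐ z ∂(ν : Measure (EuclideanSpace ℝ (Fin n))), z ∈ part.region (some i)) ∧
      ∀ g : EuclideanSpace ℝ (Fin n) → ℝ≥0∞, Measurable g →
        ∫⁻ ω in part.cylinder k y, g (ω k) ∂μ =
          μ (part.cylinder k y) * ∫⁻ z, g z ∂(ν : Measure (EuclideanSpace ℝ (Fin n))) := by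
  have hk : Measurable fun ω : ℕ → EuclideanSpace ℝ (Fin n) => ω k := measurable_pi_apply k
  by_cases h0 : μ (part.cylinder k y) = 0
  -- On a null cylinder any law carried by the region will do; nonemptiness of the cell supplies a
  -- point mass.
  · obtain ⟨z, hz⟩ := part.nonempty_cell i
    refine ⟨⟨Measure.dirac z, inferInstance⟩, ?_, fun g _ => ?_⟩
    · exact (ae_dirac_iff (part.measurableSet_region (some i))).2 hz
    · rw [Measure.restrict_eq_zero.2 h0, h0]; simp
  · have := cond_isProbabilityMeasure (μ := μ) h0
    refine ⟨⟨(μ[|part.cylinder k y]).map fun ω => ω k,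
      Measure.isProbabilityMeasure_map hk.aemeasurable⟩, ?_, fun g hg => ?_⟩
    · refine (ae_map_iff hk.aemeasurable (part.measurableSet_region (some i))).2 ?_
      refine ae_cond_of_forall_mem (part.measurableSet_cylinder k y) fun ω hω => ?_
      exact (part.J_eq_iff _ _).1 ((hω (Fin.last k)).trans hi)
    · rw [ProbabilityMeasure.coe_mk, lintegral_map hg hk, ProbabilityTheory.cond,
        lintegral_smul_measure, smul_eq_mul, ← mul_assoc,
        ENNReal.mul_inv_cancel h0 (measure_ne_top _ _), one_mul]

/-- There is an adversary whose moves are the averages of the true one-step laws, conditional on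
the abstract states visited so far. -/
theorem exists_adversary {s ε : ℝ} (hs : 1 ≤ s) (hε : 0 ≤ ε)
    {pnom p : ProbabilityMeasure (EuclideanSpace ℝ (Fin n))} (hp : p ∈ ambiguitySet s ε pnom)
    {I : IntervalMDP (AbsState ι) (Fin m)} (hI : part.IsNominalAbstraction sys pnom I)
    (μ : Measure (ℕ → EuclideanSpace ℝ (Fin n))) [IsProbabilityMeasure μ] :
    ∃ ξ : (part.robustAbstraction s ε I).Adversary, ∀ (ω : FinPath (AbsState ι) (Fin m))
      (u : Fin m) (q : AbsState ι), ω.last ∈ part.safe →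
      ∫⁻ x in part.cylinder ω.1 ω.2.1, sys.transition p u (x ω.1) (part.region q) ∂μ =
        μ (part.cylinder ω.1 ω.2.1) * (ξ.toFun ω u : Measure (AbsState ι)) {q} := by
  have key : ∀ (ω : FinPath (AbsState ι) (Fin m)) (u : Fin m),
      ∃ γ ∈ (part.robustAbstraction s ε I).Γ ω.last u, ∀ q, ω.last ∈ part.safe →
      ∫⁻ x in part.cylinder ω.1 ω.2.1, sys.transition p u (x ω.1) (part.region q) ∂μ =
        μ (part.cylinder ω.1 ω.2.1) * (γ : Measure (AbsState ι)) {q} := by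
    intro ω u
    rcases hl : ω.last with _ | i
    -- After an unsafe last state only admissibility matters; the averaging identity is vacuous.
    · exact ⟨_, part.dirac_none_mem_robust sys hI u, fun q ⟨i, hi⟩ => by cases hi⟩
    · obtain ⟨ν, hν, hint⟩ := part.exists_condLaw μ ω.1 ω.2.1 hl
      refine ⟨part.stepLaw sys p ν u, part.stepLaw_mem_robust sys hs hε hp hI ν i hν u,
        fun q _ => ?_⟩
      rw [stepLaw_singleton]
      refine hint (fun z => sys.transition p u z (part.region q)) ?_
      have hB : MeasurableSet ((fun z : EuclideanSpace ℝ (Fin n) × EuclideanSpace ℝ (Fin n) =>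
          sys.f u z.1 + z.2) ⁻¹' part.region q) :=
        sys.measurable_step u (part.measurableSet_region q)
      convert measurable_measure_prodMk_left
        (ν := (p : Measure (EuclideanSpace ℝ (Fin n)))) hB using 2 with y
      rw [SwitchedSystem.transition,
        Measure.map_apply (measurable_const_add _) (part.measurableSet_region q)]
      rfl
  choose γ hγ hγ' using key
  exact ⟨⟨γ, hγ⟩, fun ω u q => hγ' ω u q⟩

/-! ### Agreement of the concrete and abstract laws -/

/-- Safety is required only strictly before time `k`: the last state may be unsafe, since the
adversary has to match only the transitions leaving safe states. -/
theorem pathLaw_cylinder_eq {s ε : ℝ} {p : ProbabilityMeasure (EuclideanSpace ℝ (Fin n))}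
    {I : IntervalMDP (AbsState ι) (Fin m)} (σ : Strategy (AbsState ι) (Fin m))
    (x : EuclideanSpace ℝ (Fin n)) (ξ : (part.robustAbstraction s ε I).Adversary)
    (hξ : ∀ (ω : FinPath (AbsState ι) (Fin m)) (u : Fin m) (q : AbsState ι), ω.last ∈ part.safe →
      ∫⁻ x in part.cylinder ω.1 ω.2.1, sys.transition p u (x ω.1) (part.region q)
          ∂pathLaw (part.refine σ).toFun (part.refine σ).measurable_toFun (sys.kernel p) x =
        pathLaw (part.refine σ).toFun (part.refine σ).measurable_toFun (sys.kernel p) x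
          (part.cylinder ω.1 ω.2.1) * (ξ.toFun ω u : Measure (AbsState ι)) {q})
    (k : ℕ) (y : Fin (k + 1) → AbsState ι) (hy : ∀ i : Fin k, y i.castSucc ∈ part.safe) :
    pathLaw (part.refine σ).toFun (part.refine σ).measurable_toFun (sys.kernel p) x
        (part.cylinder k y) =
      pathLaw σ Measurable.of_discrete ξ.kernel (part.J x) (statePrefix k ⁻¹' {y}) := by
  induction k with
  | zero =>
    have h1 : part.cylinder 0 y = (fun ω => ω 0) ⁻¹' (part.J ⁻¹' {y 0}) := by
      ext ω; simp [cylinder, statePrefix]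
    have h2 : (statePrefix 0 ⁻¹' {y} : Set (ℕ → AbsState ι)) = (fun ω => ω 0) ⁻¹' {y 0} := by
      ext ω; simp [statePrefix, funext_iff]
    rw [h1, h2, ← Measure.map_apply (measurable_pi_apply 0)
        (part.measurable_J (measurableSet_singleton _)),
      ← Measure.map_apply (measurable_pi_apply 0) (measurableSet_singleton _),
      pathLaw_map_zero, pathLaw_map_zero,
      Measure.dirac_apply' _ (part.measurable_J (measurableSet_singleton _)),
      Measure.dirac_apply' _ (measurableSet_singleton _)]
    rfl
  | succ k ih =>
    have hsafe : (σ.path k (Fin.init y)).last ∈ part.safe := hy (Fin.last k)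
    have h := hξ (σ.path k (Fin.init y)) (σ (σ.path k (Fin.init y))) (y (Fin.last (k + 1))) hsafe
    rw [cylinder_succ, statePrefix_preimage_singleton_succ, cylinder,
      pathLaw_succ _ _ _ _ _ (part.measurableSet_prefix k _) (part.measurableSet_region _),
      pathLaw_succ _ _ _ _ _ (measurableSet_singleton _) (measurableSet_singleton _)]
    -- On the cylinder the chosen mode is constant, so the concrete integrand depends on `ω` only
    -- through `ω k`, which is the form handled by `hξ`.
    have hl : ∀ ω ∈ part.cylinder k (Fin.init y),
        sys.kernel p ((part.refine σ).toFun.path k (statePrefix k ω),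
          (part.refine σ).toFun ((part.refine σ).toFun.path k (statePrefix k ω)))
            (part.region (y (Fin.last (k + 1)))) =
          sys.transition p (σ (σ.path k (Fin.init y))) (ω k)
            (part.region (y (Fin.last (k + 1)))) := by
      intro ω hω
      have he : (fun i => part.J (statePrefix k ω i)) = Fin.init y := funext hω
      have hu : (part.refine σ).toFun ((part.refine σ).toFun.path k (statePrefix k ω)) =
          σ (σ.path k (Fin.init y)) := by
        rw [← he]
        exact congrArg σ (Strategy.map_path_comp_map part.J σ k (statePrefix k ω))
      rw [hu]
      rfl
    have hr : ∀ ω ∈ (statePrefix k ⁻¹' {Fin.init y} : Set (ℕ → AbsState ι)),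
        ξ.kernel (σ.path k (statePrefix k ω), σ (σ.path k (statePrefix k ω)))
          {y (Fin.last (k + 1))} =
        (ξ.toFun (σ.path k (Fin.init y)) (σ (σ.path k (Fin.init y))) : Measure (AbsState ι))
          {y (Fin.last (k + 1))} := by
      intro ω hω
      rw [Set.mem_preimage, Set.mem_singleton_iff] at hω
      rw [hω]
      rfl
    rw [setLIntegral_congr_fun (measurable_statePrefix k (measurableSet_singleton _)) hr,
      setLIntegral_const, ← ih (Fin.init y) fun i => hy i.castSucc, mul_comm]
    exact (setLIntegral_congr_fun (part.measurableSet_cylinder k _) hl).trans h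

/-- Some adversary of the robust abstraction reproduces the reach-avoid probability of the
system. -/
theorem exists_adversary_reachProb_eq {s ε : ℝ} (hs : 1 ≤ s) (hε : 0 ≤ ε) (hXtgt : Xtgt ⊆ X)
    {pnom p : ProbabilityMeasure (EuclideanSpace ℝ (Fin n))} (hp : p ∈ ambiguitySet s ε pnom)
    {I : IntervalMDP (AbsState ι) (Fin m)} (hI : part.IsNominalAbstraction sys pnom I)
    (K : ℕ∞) (σ : Strategy (AbsState ι) (Fin m)) (x : EuclideanSpace ℝ (Fin n)) :
    ∃ ξ : (part.robustAbstraction s ε I).Adversary,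
      (part.robustAbstraction s ε I).reachProb part.safe part.target K (part.J x) σ ξ =
        sys.reachProb X Xtgt K x (part.refine σ) p := by
  obtain ⟨ξ, hξ⟩ := part.exists_adversary sys hs hε hp hI
    (pathLaw (part.refine σ).toFun (part.refine σ).measurable_toFun (sys.kernel p) x)
  refine ⟨ξ, ?_⟩
  have hJ : Measurable fun (ω : ℕ → EuclideanSpace ℝ (Fin n)) k => part.J (ω k) :=
    measurable_pi_lambda _ fun k => part.measurable_J.comp (measurable_pi_apply k)
  have hmeas : MeasurableSet (reachAvoid part.safe part.target K) := by
    rw [reachAvoid_eq_iUnion]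
    exact MeasurableSet.iUnion fun z => measurable_statePrefix _ (measurableSet_singleton _)
  -- The concrete event is a `J`-preimage, so its probability is that of the abstract event under
  -- the image law; comparison on cylinders then suffices.
  rw [SwitchedSystem.reachProb, ← part.preimage_reachAvoid hXtgt, ← Measure.map_apply hJ hmeas]
  refine measure_reachAvoid_congr _ K fun k y hy => ?_
  rw [Measure.map_apply hJ (measurable_statePrefix k (measurableSet_singleton _)),
    ← part.pathLaw_cylinder_eq sys σ x ξ hξ k y hy]
  congr 1
  ext ω
  simp [cylinder, statePrefix, funext_iff]

end SafePartition

end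

theorem mainTheorem3 {n m : ℕ} (sys : SwitchedSystem n m)
    (s : ℝ) (hs : 1 ≤ s) (ε : ℝ) (hε : 0 ≤ ε)
    (pnom : ProbabilityMeasure (EuclideanSpace ℝ (Fin n)))
    (hpnom : pnom ∈ finiteMoment (EuclideanSpace ℝ (Fin n)) s)
    (X Xtgt : Set (EuclideanSpace ℝ (Fin n))) (hX : Bornology.IsBounded X) (hXtgt : Xtgt ⊆ X)
    {ι : Type*} [Fintype ι] (part : SafePartition X Xtgt ι)
    (I : IntervalMDP (AbsState ι) (Fin m)) (hI : part.IsNominalAbstraction sys pnom I)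
    (K : ℕ∞) (σ : Strategy (AbsState ι) (Fin m))
    (hσ : (part.robustAbstraction s ε I).IsOptimal part.safe part.target K σ)
    (q : AbsState ι) (x : EuclideanSpace ℝ (Fin n)) (hx : x ∈ part.region q)
    (p : ProbabilityMeasure (EuclideanSpace ℝ (Fin n))) (hp : p ∈ ambiguitySet s ε pnom) :
    (part.robustAbstraction s ε I).lowerBound part.safe part.target K σ q ≤
        sys.reachProb X Xtgt K x (part.refine σ) p ∧
      sys.reachProb X Xtgt K x (part.refine σ) p ≤
        (part.robustAbstraction s ε I).upperBound part.safe part.target K σ q := by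
  obtain rfl : part.J x = q := (part.J_eq_iff x q).2 hx
  obtain ⟨ξ, hξ⟩ := part.exists_adversary_reachProb_eq sys hs hε hXtgt hp hI K σ x
  rw [← hξ]
  exact ⟨iInf_le _ ξ, le_iSup (fun ξ => (part.robustAbstraction s ε I).reachProb part.safe
    part.target K (part.J x) σ ξ) ξ⟩
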